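/- Let $\beta$ be a formal parameter and let $\Lambda$ be the $\mathbb{Q}(\beta)$-algebra of symmetric functions in $x=(x_1,x_2,\dots)$. Let $g\Gamma\subset\Lambda$ be the subalgebra of all $f\in\Lambda$ such that $f(t,-t-\beta,x_3,x_4,\dots)$ is independent of $t$. Let $p_n=\sum_i x_i^n$ and put $$p_n^{[\beta]}=\sum_{k=0}^{n-1}\binom{n}{k}\Bigl(\frac{\beta}{2}\Bigr)^k p_{n-k}\qquad(n\ge 1).$$ With $\overline z=\dfrac{-z}{1+\beta z}$, define $q_n^{[\beta]}$ and $\overline q_n^{[\beta]}$ for $n\ge 0$ by the generating functions $$Q^{[\beta]}(z)=\sum_{n\ge 0}q_n^{[\beta]}z^n=\prod_i\frac{1-x_i\overline z}{1-x_iz},\qquad \sum_{n\ge 0}\overline q_n^{[\beta]}z^n=Q^{[\beta]}(\overline z)$$ (expanded as power series in $z$). For a partition $\lambda=(\lambda_1\ge\dots\ge\lambda_\ell>0)$ put $p_\lambda^{[\beta]}=\prod_{j=1}^{\ell}p_{\lambda_j}^{[\beta]}$, $q_\lambda^{[\beta]}=\prod_{j=1}^{\ell}q_{\lambda_j}^{[\beta]}$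 and $\overline q_\lambda^{[\beta]}=\prod_{j=1}^{\ell}\overline q_{\lambda_j}^{[\beta]}$. Let $\mathcal{OP}$ be the set of partitions all of whose parts are odd, and $\mathcal{SP}$ the set of partitions whose parts are pairwise distinct; both contain the empty partition, whose product is $1$. **Theorem.** Each of the following five families is a $\mathbb{Q}(\beta)$-basis of $g\Gamma$: $$\text{(i) }\{p_\lambda^{[\beta]}\}_{\lambda\in\mathcal{OP}},\quad \text{(ii) }\{q_\lambda^{[\beta]}\}_{\lambda\in\mathcal{OP}},\quad \text{(iii) }\{\overline q_\lambda^{[\beta]}\}_{\lambda\in\mathcal{OP}},\quad \text{(iv) }\{q_\lambda^{[\beta]}\}_{\lambda\in\mathcal{SP}},\quad \text{(v) }\{\overline q_\lambda^{[\beta]}\}_{\lambda\in\mathcal{SP}}.$$ -/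

import Mathlib

namespace DualKQ

noncomputable section

/-- The field `ℚ(β)` of rational functions in the formal parameter `β`. -/
abbrev K : Type := RatFunc ℚ

/-- The formal parameter `β`. -/
def β : K := RatFunc.X

/-- Families `(f_N)` with `f_N` a polynomial in `x_1, …, x_N` over `ℚ(β)`, `N = 0, 1, 2, …`
(with componentwise operations).  A symmetric function `f(x_1, x_2, …)` is the family of its
restrictions `f_N = f(x_1, …, x_N, 0, 0, …)`. -/
abbrev Fam : Type := ∀ N : ℕ, MvPolynomial (Fin N) K

/-- The specialization `f(x_1, …, x_N, x_{N+1}) ↦ f(x_1, …, x_N, 0)`. -/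
def setLastZero (N : ℕ) : MvPolynomial (Fin (N + 1)) K →ₐ[K] MvPolynomial (Fin N) K :=
  MvPolynomial.aeval
    (Fin.snoc (α := fun _ => MvPolynomial (Fin N) K) (fun i => MvPolynomial.X i) 0)

/-- The `ℚ(β)`-algebra `Λ` of symmetric functions: compatible families of symmetric polynomials
of bounded degree. -/
def SymFun : Subalgebra K Fam where
  carrier := {f | (∀ N, (f N).IsSymmetric) ∧ (∀ N, setLastZero N (f (N + 1)) = f N) ∧
    ∃ d : ℕ, ∀ N, (f N).totalDegree ≤ d}
  mul_mem' := by
    rintro f g ⟨hf, hf', d, hd⟩ ⟨hg, hg', e, he⟩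
    refine ⟨fun N => (hf N).mul (hg N), fun N => ?_, d + e, fun N => ?_⟩
    · simp only [Pi.mul_apply, map_mul, hf', hg']
    · exact (MvPolynomial.totalDegree_mul _ _).trans (add_le_add (hd N) (he N))
  add_mem' := by
    rintro f g ⟨hf, hf', d, hd⟩ ⟨hg, hg', e, he⟩
    refine ⟨fun N => (hf N).add (hg N), fun N => ?_, max d e, fun N => ?_⟩
    · simp only [Pi.add_apply, map_add, hf', hg']
    · exact (MvPolynomial.totalDegree_add _ _).trans (max_le_max (hd N) (he N))
  algebraMap_mem' := by
    intro r
    refine ⟨fun N => MvPolynomial.IsSymmetric.C r, fun N => ?_, 0, fun N => ?_⟩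
    · exact (setLastZero N).commutes r
    · exact (MvPolynomial.totalDegree_C r).le

/-- The substitution `f(x_1, x_2, x_3, …, x_{N+2}) ↦ f(t, -t - β, x_3, …, x_{N+2})`, with values in
the polynomials in the remaining `N` variables with coefficients in `ℚ(β)[t]`. -/
def cancelSubst (N : ℕ) :
    MvPolynomial (Fin (N + 2)) K →ₐ[K] MvPolynomial (Fin N) (Polynomial K) :=
  MvPolynomial.aeval
    (Fin.cons (α := fun _ => MvPolynomial (Fin N) (Polynomial K))
      (MvPolynomial.C Polynomial.X)
      (Fin.cons (α := fun _ => MvPolynomial (Fin N) (Polynomial K))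
        (MvPolynomial.C (-Polynomial.X - Polynomial.C β)) (fun i => MvPolynomial.X i)))

/-- The polynomials over `ℚ(β)[t]` that are independent of `t`, that is, all of whose
coefficients are constants in `ℚ(β)`. -/
def indepOfT (N : ℕ) : Subalgebra K (MvPolynomial (Fin N) (Polynomial K)) :=
  (MvPolynomial.mapAlgHom (σ := Fin N) (Polynomial.CAlgHom (R := K) (A := K))).range

/-- The dual `K`-`Q`-cancellation property: `f(t, -t - β, x_3, x_4, …)` is independent of `t`. -/
def DualKQCancellation (f : Fam) : Prop :=
  ∀ N : ℕ, cancelSubst N (f (N + 2)) ∈ indepOfT N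

/-- The algebra `gΓ` of symmetric functions with the dual `K`-`Q`-cancellation property. -/
def gGamma : Subalgebra K Fam where
  carrier := {f | f ∈ SymFun ∧ DualKQCancellation f}
  mul_mem' := by
    rintro f g ⟨hf, hf'⟩ ⟨hg, hg'⟩
    refine ⟨mul_mem hf hg, fun N => ?_⟩
    simp only [Pi.mul_apply, map_mul]
    exact mul_mem (hf' N) (hg' N)
  add_mem' := by
    rintro f g ⟨hf, hf'⟩ ⟨hg, hg'⟩
    refine ⟨add_mem hf hg, fun N => ?_⟩
    simp only [Pi.add_apply, map_add]
    exact add_mem (hf' N) (hg' N)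
  algebraMap_mem' := by
    intro r
    refine ⟨SymFun.algebraMap_mem r, fun N => ?_⟩
    have h : cancelSubst N (algebraMap K Fam r (N + 2)) =
        algebraMap K (MvPolynomial (Fin N) (Polynomial K)) r := (cancelSubst N).commutes r
    rw [h]
    exact (indepOfT N).algebraMap_mem r

/-- The power sum `p_n = x_1^n + x_2^n + ⋯`. -/
def p (n : ℕ) : Fam := fun N => MvPolynomial.psum (Fin N) K n

/-- The power sum `p_n^{[β]} = ∑_{k=0}^{n-1} (n choose k) (β/2)^k p_{n-k}`. -/
def pB (n : ℕ) : Fam :=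
  ∑ k ∈ Finset.range n, ((n.choose k : K) * (β / 2) ^ k) • p (n - k)

/-- The power series `z̄ = -z / (1 + β z)`, with coefficients in `ℚ(β)[x_1, …, x_N]`. -/
def zbar (N : ℕ) : PowerSeries (MvPolynomial (Fin N) K) :=
  -PowerSeries.X *
    PowerSeries.invOfUnit (1 + PowerSeries.C (MvPolynomial.C β) * PowerSeries.X) 1

/-- The generating function `Q^{[β]}(z) = ∏_i (1 - x_i z̄) / (1 - x_i z)` in `N` variables. -/
def Qser (N : ℕ) : PowerSeries (MvPolynomial (Fin N) K) :=
  ∏ i : Fin N,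
    ((1 - PowerSeries.C (MvPolynomial.X i) * zbar N) *
      PowerSeries.invOfUnit (1 - PowerSeries.C (MvPolynomial.X i) * PowerSeries.X) 1)

/-- The generating function `Q̄^{[β]}(z) = Q^{[β]}(z̄)` in `N` variables. -/
def Qbarser (N : ℕ) : PowerSeries (MvPolynomial (Fin N) K) :=
  PowerSeries.subst (zbar N) (Qser N)

/-- `q_n^{[β]}`, the coefficient of `z^n` in `Q^{[β]}(z)`. -/
def qB (n : ℕ) : Fam := fun N => PowerSeries.coeff n (Qser N)

/-- The coefficient of `z^n` in `Q̄^{[β]}(z)`. -/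
def qbarB (n : ℕ) : Fam := fun N => PowerSeries.coeff n (Qbarser N)

/-- The set of all partitions (of all nonnegative integers, including the empty partition). -/
abbrev Part : Type := Σ n : ℕ, Nat.Partition n

/-- Odd partitions: all parts are odd. -/
abbrev OddPart : Type := {l : Part // ∀ i ∈ l.2.parts, Odd i}

/-- Strict partitions: all parts are distinct. -/
abbrev StrictPart : Type := {l : Part // l.2.parts.Nodup}

/-- The product `a_λ = a_{λ_1} a_{λ_2} ⋯` over the parts of a partition `λ`. -/
def partProd (a : ℕ → Fam) (l : Part) : Fam := (l.2.parts.map a).prod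

/-- The family `v` consists of elements of `gΓ` and is a `ℚ(β)`-basis of it. -/
def IsBasisOfGGamma {ι : Type} (v : ι → Fam) : Prop :=
  ∃ b : Module.Basis ι K gGamma, ∀ i, (b i : Fam) = v i

end

end DualKQ

/-!
The family `p_n^{[β]}` is `∑_i ((x_i + β/2)^n - (β/2)^n)`, so it is triangular in the power sums and
a pair of variables `t, -t - β` contributes `u^n + (-u)^n - 2 (β/2)^n` to it, where `u = t + β/2`.
For odd `n` this is constant, hence `p_n^{[β]} ∈ gΓ`. Conversely, every symmetric function is a
polynomial `P` in the `p_n^{[β]}` (`SymFun.exists_aeval_pB`), which are algebraically independent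
(`algebraicIndependent_pB`). If it lies in `gΓ`, then `P` is invariant under translation by the
vectors `(u^n + (-u)^n)_n`. The invariant directions form a linear subspace, and these vectors span
all directions supported on even `n`; so the even variables in `P` may be set to zero
(`exists_mem_filt_of_mem_gGamma`). This gives the basis of products of the `p_n^{[β]}` over odd
partitions.

For the other four families let `A(z) = ∑ a_n z^n` be `Q^{[β]}(z)` or `Q^{[β]}(z̄)`, and filter by
weight: a product of terms of index `n_1, n_2, …` has weight `n_1 + n_2 + ⋯`.
* The logarithmic derivative of `A` has coefficients that are combinations of the `p_m^{[β]}` with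
  `m` odd (`logCoeff`). Hence, compatibly with weights, the `a_n` and the odd `p_n^{[β]}` are
  polynomials in each other (`qB_mem_filt`, `filt_pB_le_filt_qB` and their analogues for `q̄`).
* Since `z ↦ z̄` is an involution, `A(z) A(z̄) = 1`. In degree `2n` this relation (`QuadRel`)
  eliminates `a_{2n}` in favour of terms of smaller index, and it also rewrites `a_n^2` through
  products of smaller weight or with more spread out indices. So the products over odd partitions,
  and those over strict partitions, span the polynomials in the `a_n`, again compatibly with weights
  (`QuadRel.filt_univ_le_odd`, `QuadRel.filt_univ_le_strictFilt`).

Linear independence then follows by counting: in weight at most `n` there are as many strict as odd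
partitions by Euler's theorem, so each of the four families has as many members there as the
dimension of a space contained in their span (`isBasisOfGGamma_of_span`).
-/

namespace DualKQ

noncomputable section

/-! ### Weight filtrations and the quadratic relations -/

section Filtration

variable {𝕜 R : Type*} [Field 𝕜] [CommRing R] [Algebra 𝕜 R]

variable (𝕜) in
/-- The span of the products `∏_{i ∈ s} a i` over the multisets `s` of elements of `S` whose sum
(the weight of the product) is at most `n`. -/
def filt (a : ℕ → R) (S : Set ℕ) (n : ℕ) : Submodule 𝕜 R :=
  Submodule.span 𝕜 {x | ∃ s : Multiset ℕ, (∀ i ∈ s, i ∈ S) ∧ s.sum ≤ n ∧ (s.map a).prod = x}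

variable (𝕜) in
/-- The span of the products `∏_{i ∈ s} a i` over the sets `s` of positive integers whose sum is at
most `n`. -/
def strictFilt (a : ℕ → R) (n : ℕ) : Submodule 𝕜 R :=
  Submodule.span 𝕜 {x | ∃ s : Multiset ℕ, s.Nodup ∧ 0 ∉ s ∧ s.sum ≤ n ∧ (s.map a).prod = x}

variable {a b : ℕ → R} {S T : Set ℕ} {m n : ℕ}

theorem filt_mono (h : m ≤ n) : filt 𝕜 a S m ≤ filt 𝕜 a S n :=
  Submodule.span_mono fun _ ⟨s, h1, h2, h3⟩ => ⟨s, h1, h2.trans h, h3⟩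

theorem strictFilt_mono (h : m ≤ n) : strictFilt 𝕜 a m ≤ strictFilt 𝕜 a n :=
  Submodule.span_mono fun _ ⟨s, h1, h0, h2, h3⟩ => ⟨s, h1, h0, h2.trans h, h3⟩

theorem prod_mem_filt {s : Multiset ℕ} (hs : ∀ i ∈ s, i ∈ S) (hn : s.sum ≤ n) :
    (s.map a).prod ∈ filt 𝕜 a S n :=
  Submodule.subset_span ⟨s, hs, hn, rfl⟩

theorem one_mem_filt : (1 : R) ∈ filt 𝕜 a S n := by
  simpa using prod_mem_filt (𝕜 := 𝕜) (a := a) (S := S) (n := n) (s := 0) (by simp) (by simp)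

theorem self_mem_filt {i : ℕ} (hi : i ∈ S) (hn : i ≤ n) : a i ∈ filt 𝕜 a S n := by
  simpa using prod_mem_filt (𝕜 := 𝕜) (a := a) (S := S) (n := n) (s := {i}) (by simpa) (by simpa)

theorem mul_mem_filt {x y : R} (hx : x ∈ filt 𝕜 a S m) (hy : y ∈ filt 𝕜 a S n) :
    x * y ∈ filt 𝕜 a S (m + n) := by
  have h := Submodule.mul_mem_mul hx hy
  rw [filt, filt, Submodule.span_mul_span] at h
  refine Submodule.span_mono ?_ h
  rintro _ ⟨_, ⟨s, hs, hs', rfl⟩, _, ⟨t, ht, ht', rfl⟩, rfl⟩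
  refine ⟨s + t, fun i hi => ?_, by simpa using add_le_add hs' ht', by simp⟩
  exact (Multiset.mem_add.1 hi).elim (hs i) (ht i)

theorem filt_le_filt (h : ∀ i ∈ T, b i ∈ filt 𝕜 a S i) : filt 𝕜 b T n ≤ filt 𝕜 a S n := by
  refine Submodule.span_le.2 ?_
  rintro _ ⟨s, hs, hn, rfl⟩
  refine filt_mono hn ?_
  clear hn
  induction s using Multiset.induction_on with
  | empty => simpa using one_mem_filt
  | cons i s ih =>
    simp only [Multiset.map_cons, Multiset.prod_cons, Multiset.sum_cons]
    exact mul_mem_filt (h i (hs i (by simp))) (ih fun j hj => hs j (by simp [hj]))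

variable (𝕜) in
/-- The coefficientwise form of a relation `A(z) A(w(z)) = 1` for `A(z) = ∑ a_n z^n`, where
`w(z) = -z + ⋯` has coefficients in `𝕜` and `c m j` is the coefficient of `z^j` in `w(z)^m`. -/
def QuadRel (a : ℕ → R) : Prop :=
  ∃ c : ℕ → ℕ → 𝕜, (∀ m, c m m = (-1) ^ m) ∧ ∀ N, 0 < N →
    ∑ q ∈ Finset.HasAntidiagonal.antidiagonal N,
      ∑ m ∈ Finset.range (q.2 + 1), c m q.2 • (a q.1 * a m) = 0

/-- The relation in degree `2n` expresses `a n ^ 2` through the other products `a i * a m` with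
`i + m ≤ 2n`. -/
theorem QuadRel.sq_mem (h : QuadRel 𝕜 a) {V : Submodule 𝕜 R} {t : R} (hn : 0 < n)
    (H : ∀ i m, i + m ≤ 2 * n → ¬(i = n ∧ m = n) → a i * a m * t ∈ V) :
    a n * a n * t ∈ V := by
  obtain ⟨c, hc, h⟩ := h
  have h := h (2 * n) (by omega)
  -- Isolate the term `q = (n, n)`, `m = n`, whose coefficient is `(-1)^n`.
  rw [← Finset.add_sum_erase _ _ (a := (n, n)) (by simp; omega), Finset.sum_range_succ, hc] at h
  have h2 : ∑ q ∈ (Finset.HasAntidiagonal.antidiagonal (2 * n)).erase (n, n),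
      ∑ m ∈ Finset.range (q.2 + 1), c m q.2 • (a q.1 * a m) * t ∈ V := by
    refine Submodule.sum_mem _ fun q hq => Submodule.sum_mem _ fun m hm => ?_
    rw [Finset.mem_erase, Finset.HasAntidiagonal.mem_antidiagonal] at hq
    rw [Finset.mem_range] at hm
    rw [smul_mul_assoc]
    refine V.smul_mem _ (H _ _ (by omega) ?_)
    rintro ⟨h1, h2⟩
    exact hq.1 (Prod.ext h1 (by simp; omega))
  have h1 : ∑ m ∈ Finset.range n, c m n • (a n * a m) * t ∈ V := by
    refine Submodule.sum_mem _ fun m hm => ?_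
    rw [Finset.mem_range] at hm
    rw [smul_mul_assoc]
    exact V.smul_mem _ (H _ _ (by omega) (by omega))
  have h3 : a n * a n * t = -((-1 : 𝕜) ^ n • (∑ m ∈ Finset.range n, c m n • (a n * a m) * t +
      ∑ q ∈ (Finset.HasAntidiagonal.antidiagonal (2 * n)).erase (n, n),
      ∑ m ∈ Finset.range (q.2 + 1), c m q.2 • (a q.1 * a m) * t)) := by
    have h4 := congrArg (fun x => (-1 : 𝕜) ^ n • (x * t)) h
    simp only [add_mul, Finset.sum_mul, zero_mul, smul_zero, smul_add, smul_mul_assoc, smul_smul,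
      ← mul_pow] at h4 ⊢
    norm_num at h4
    linear_combination h4
  rw [h3]
  exact V.neg_mem (V.smul_mem _ (V.add_mem h1 h2))

/-- In even degree `2n` the relation expresses `a (2n)` through products of terms of smaller
index. -/
theorem QuadRel.mem_filt_odd [CharZero 𝕜] (h : QuadRel 𝕜 a) (h0 : a 0 = 1) (n : ℕ) :
    a n ∈ filt 𝕜 a {i | Odd i} n := by
  induction n using Nat.strong_induction_on with
  | _ n ih =>
    rcases Nat.eq_zero_or_pos n with rfl | hn
    · rw [h0]; exact one_mem_filt
    rcases Nat.even_or_odd n with he | ho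
    swap
    · exact self_mem_filt ho le_rfl
    obtain ⟨c, hc, h⟩ := h
    -- For even `n` the terms `a 0 * a n` and `a n * a 0` both have coefficient `1`.
    have h := h n hn
    rw [← Finset.add_sum_erase _ _ (a := (0, n)) (by simp), Finset.sum_range_succ, hc,
      ← Finset.add_sum_erase _ _ (a := (n, 0)) (by simp; omega)] at h
    simp only [zero_add, Finset.range_one, Finset.sum_singleton, hc, h0, he.neg_one_pow,
      pow_zero, one_smul, one_mul, mul_one] at h
    have h1 : ∑ m ∈ Finset.range n, c m n • a m ∈ filt 𝕜 a {i | Odd i} n := by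
      refine Submodule.sum_mem _ fun m hm => Submodule.smul_mem _ _ ?_
      rw [Finset.mem_range] at hm
      exact filt_mono hm.le (ih m hm)
    have h2 : ∑ q ∈ ((Finset.HasAntidiagonal.antidiagonal n).erase (0, n)).erase (n, 0),
        ∑ m ∈ Finset.range (q.2 + 1), c m q.2 • (a q.1 * a m) ∈ filt 𝕜 a {i | Odd i} n := by
      refine Submodule.sum_mem _ fun q hq => Submodule.sum_mem _ fun m hm =>
        Submodule.smul_mem _ _ ?_
      obtain ⟨i, j⟩ := q
      simp only [Finset.mem_erase, Finset.HasAntidiagonal.mem_antidiagonal, Finset.mem_range, ne_eq,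
        Prod.mk.injEq] at hq hm
      exact filt_mono (by omega) (mul_mem_filt (ih i (by omega)) (ih m (by omega)))
    have h3 : a n = (2 : 𝕜)⁻¹ • -(∑ m ∈ Finset.range n, c m n • a m +
        ∑ q ∈ ((Finset.HasAntidiagonal.antidiagonal n).erase (0, n)).erase (n, 0),
        ∑ m ∈ Finset.range (q.2 + 1), c m q.2 • (a q.1 * a m)) := by
      rw [eq_inv_smul_iff₀ two_ne_zero, two_smul]
      linear_combination h
    rw [h3]
    exact Submodule.smul_mem _ _ (Submodule.neg_mem _ (Submodule.add_mem _ h1 h2))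

theorem QuadRel.filt_univ_le_odd [CharZero 𝕜] (h : QuadRel 𝕜 a) (h0 : a 0 = 1) (n : ℕ) :
    filt 𝕜 a Set.univ n ≤ filt 𝕜 a {i | Odd i} n :=
  filt_le_filt fun i _ => h.mem_filt_odd h0 i

theorem sum_filter_ne_zero (s : Multiset ℕ) : (s.filter (· ≠ 0)).sum = s.sum := by
  simpa using (Nat.Partition.ofMultiset s).parts_sum

theorem prod_map_filter_ne_zero (h0 : a 0 = 1) (s : Multiset ℕ) :
    ((s.filter (· ≠ 0)).map a).prod = (s.map a).prod := by
  induction s using Multiset.induction_on with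
  | empty => simp
  | cons i s ih => by_cases hi : i = 0 <;> simp_all

theorem sum_sq_le_sq_sum (s : Multiset ℕ) : (s.map (· ^ 2)).sum ≤ s.sum ^ 2 := by
  induction s using Multiset.induction_on with
  | empty => simp
  | cons i s ih =>
    simp only [Multiset.map_cons, Multiset.sum_cons]
    nlinarith [Nat.zero_le (i * s.sum)]

/-- Straightening: a repeated factor `a n * a n` is replaced by products `a i * a m` that either
have smaller weight, or have the same weight and a larger sum of squares of indices. -/
theorem QuadRel.prod_mem_strictFilt (h : QuadRel 𝕜 a) (h0 : a 0 = 1) (s : Multiset ℕ) :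
    (s.map a).prod ∈ strictFilt 𝕜 a s.sum := by
  -- Induction on the weight `w`, then on the gap `k` between `w ^ 2` and the sum of squares.
  suffices H : ∀ w k, ∀ s : Multiset ℕ, s.sum = w → (s.map (· ^ 2)).sum + k = w ^ 2 →
      (s.map a).prod ∈ strictFilt 𝕜 a w from
    H s.sum (s.sum ^ 2 - (s.map (· ^ 2)).sum) s rfl (Nat.add_sub_cancel' (sum_sq_le_sq_sum s))
  intro w
  induction w using Nat.strong_induction_on with
  | _ w ihw =>
  intro k
  induction k using Nat.strong_induction_on with
  | _ k ihk =>
  intro s hs hk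
  by_cases hnd : (s.filter (· ≠ 0)).Nodup
  · rw [← prod_map_filter_ne_zero h0]
    exact Submodule.subset_span ⟨_, hnd, by simp, by rw [sum_filter_ne_zero, hs], rfl⟩
  · obtain ⟨n, hn⟩ : ∃ n, 2 ≤ (s.filter (· ≠ 0)).count n := by
      by_contra! hcon
      exact hnd (Multiset.nodup_iff_count_le_one.2 fun n => Nat.le_of_lt_succ (hcon n))
    have hn0 : 0 < n := by
      rcases Nat.eq_zero_or_pos n with rfl | hn0
      · simp at hn
      · exact hn0
    have hle : n ::ₘ n ::ₘ 0 ≤ s := by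
      have := Multiset.le_count_iff_replicate_le.1 hn
      exact (this.trans (Multiset.filter_le _ _))
    obtain ⟨t, rfl⟩ := Multiset.le_iff_exists_add.1 hle
    simp only [Multiset.cons_add, zero_add, Multiset.map_cons, Multiset.prod_cons,
      Multiset.sum_cons, ← mul_assoc] at hs hk ⊢
    refine h.sq_mem hn0 fun i m him hne => ?_
    have key : ∀ w', w' = i + m + t.sum → w' ≤ w →
        a i * a m * (t.map a).prod ∈ strictFilt 𝕜 a w' := by
      intro w' hw' hle
      have hsq := sum_sq_le_sq_sum (i ::ₘ m ::ₘ t)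
      simp only [Multiset.map_cons, Multiset.sum_cons, ← add_assoc, ← hw'] at hsq
      rcases hle.lt_or_eq with hlt | heq
      · have := ihw w' hlt (w' ^ 2 - ((i ::ₘ m ::ₘ t).map (· ^ 2)).sum) (i ::ₘ m ::ₘ t)
          (by simp [hw', add_assoc]) (by
            simp only [Multiset.map_cons, Multiset.sum_cons, ← add_assoc]; omega)
        simpa [mul_assoc] using this
      · have hi : i + m = 2 * n := by omega
        have hlt : 2 * n ^ 2 < i ^ 2 + m ^ 2 := by
          have : i ≠ m := by omega
          rcases lt_or_gt_of_ne this with hl | hl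
          · obtain ⟨e, rfl⟩ := Nat.exists_eq_add_of_lt hl
            nlinarith
          · obtain ⟨e, rfl⟩ := Nat.exists_eq_add_of_lt hl
            nlinarith
        rw [heq] at hsq
        have := ihk (w ^ 2 - ((i ::ₘ m ::ₘ t).map (· ^ 2)).sum)
          (by simp only [Multiset.map_cons, Multiset.sum_cons, ← add_assoc]; omega)
          (i ::ₘ m ::ₘ t) (by simp; omega) (by
            simp only [Multiset.map_cons, Multiset.sum_cons, ← add_assoc]; omega)
        simpa [mul_assoc, heq] using this
    exact strictFilt_mono (by omega) (key _ rfl (by omega))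

theorem QuadRel.filt_univ_le_strictFilt (h : QuadRel 𝕜 a) (h0 : a 0 = 1) (n : ℕ) :
    filt 𝕜 a Set.univ n ≤ strictFilt 𝕜 a n := by
  refine Submodule.span_le.2 ?_
  rintro _ ⟨s, -, hn, rfl⟩
  exact strictFilt_mono hn (h.prod_mem_strictFilt h0 s)

end Filtration

/-! ### Logarithmic derivatives -/

section LogDeriv

variable {R : Type*} [CommRing R] [Algebra K R] {a b ℓ : ℕ → R} {ε : K} {T : Set ℕ}

/-- If `A' = ε A L` with `A(0) = 1`, the coefficients of `A` are recursively polynomials in the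
coefficients `ℓ (n + 1)` of `L`, compatibly with weights. -/
theorem mem_filt_of_logDeriv (h0 : a 0 = 1)
    (h : ∀ n : ℕ, ((n : K) + 1) • a (n + 1) =
      ε • ∑ q ∈ Finset.HasAntidiagonal.antidiagonal n, a q.1 * ℓ (q.2 + 1))
    (hℓ : ∀ n, ℓ n ∈ filt K b T n) (n : ℕ) : a n ∈ filt K b T n := by
  induction n using Nat.strong_induction_on with
  | _ n ih =>
    rcases n with _ | n
    · rw [h0]; exact one_mem_filt
    · have h1 := h n
      rw [← eq_inv_smul_iff₀ (by exact_mod_cast n.succ_ne_zero)] at h1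
      rw [h1]
      refine Submodule.smul_mem _ _ (Submodule.smul_mem _ _ (Submodule.sum_mem _ fun q hq => ?_))
      rw [Finset.HasAntidiagonal.mem_antidiagonal] at hq
      exact filt_mono (by omega) (mul_mem_filt (ih q.1 (by omega)) (hℓ (q.2 + 1)))

/-- If `A' = ε A L` with `A(0) = 1` and `ε ≠ 0`, the coefficients `ℓ (n + 1)` of `L` are recursively
polynomials in the coefficients of `A`, compatibly with weights. -/
theorem logDeriv_mem_filt (hε : ε ≠ 0) (h0 : a 0 = 1)
    (h : ∀ n : ℕ, ((n : K) + 1) • a (n + 1) =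
      ε • ∑ q ∈ Finset.HasAntidiagonal.antidiagonal n, a q.1 * ℓ (q.2 + 1))
    (n : ℕ) : ℓ (n + 1) ∈ filt K a Set.univ (n + 1) := by
  induction n using Nat.strong_induction_on with
  | _ n ih =>
    have h1 := h n
    rw [← Finset.add_sum_erase _ _ (a := (0, n)) (by simp), h0, one_mul, smul_add] at h1
    have h2 : ℓ (n + 1) = ε⁻¹ • (((n : K) + 1) • a (n + 1) -
        ε • ∑ q ∈ (Finset.HasAntidiagonal.antidiagonal n).erase (0, n), a q.1 * ℓ (q.2 + 1)) := by
      rw [eq_inv_smul_iff₀ hε]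
      linear_combination -h1
    rw [h2]
    refine Submodule.smul_mem _ _ (Submodule.sub_mem _ (Submodule.smul_mem _ _
      (self_mem_filt (Set.mem_univ _) le_rfl)) (Submodule.smul_mem _ _
      (Submodule.sum_mem _ fun q hq => ?_)))
    obtain ⟨i, j⟩ := q
    simp only [Finset.mem_erase, Finset.HasAntidiagonal.mem_antidiagonal, ne_eq, Prod.mk.injEq]
      at hq
    exact filt_mono (m := i + (j + 1)) (by omega)
      (mul_mem_filt (self_mem_filt (Set.mem_univ _) le_rfl) (ih j (by omega)))

end LogDeriv

/-! ### The generating functions of `q_n^{[β]}` -/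

section Series

open PowerSeries

variable {A : Type*} [CommRing A]

/-- The series `w(z) = -z / (1 + b z)`. -/
def involSer (b : A) : PowerSeries A := -X * invOfUnit (1 + C b * X) 1

theorem involSer_mul (b : A) : involSer b * (1 + C b * X) = -X := by
  rw [involSer, mul_assoc, mul_comm (invOfUnit _ _), mul_invOfUnit _ _ (by simp), mul_one]

theorem hasSubst_involSer (b : A) : HasSubst (involSer b) :=
  HasSubst.of_constantCoeff_zero' (by simp [involSer])

theorem subst_C_self (w : PowerSeries A) (r : A) : subst w (C r) = C r :=
  subst_C (a := w) r

theorem subst_one' {w : PowerSeries A} (hw : HasSubst w) : subst w (1 : PowerSeries A) = 1 := by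
  rw [← coe_substAlgHom hw, map_one]

theorem subst_involSer_self (b : A) : subst (involSer b) (involSer b) = X := by
  have hw := hasSubst_involSer b
  have h := involSer_mul b
  have h1 := congrArg (subst (involSer b)) h
  rw [subst_mul hw, subst_add hw, subst_mul hw, subst_X hw, subst_one' hw, subst_C_self,
    ← coe_substAlgHom hw, map_neg, coe_substAlgHom hw, subst_X hw] at h1
  linear_combination (1 + C b * X) * h1 - (1 + C b * subst (involSer b) (involSer b)) * h

theorem map_involSer {B : Type*} [CommRing B] (f : A →+* B) (b : A) :
    map f (involSer b) = involSer (f b) := by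
  have h := congrArg (map f) (involSer_mul b)
  simp only [map_mul, map_add, map_one, map_C, map_X, map_neg] at h
  have h' := involSer_mul (f b)
  have hu : (1 + C (f b) * X) * invOfUnit (1 + C (f b) * X) 1 = 1 := mul_invOfUnit _ _ (by simp)
  linear_combination (invOfUnit (1 + C (f b) * X) 1) * (h - h') -
    (map f (involSer b) - involSer (f b)) * hu

theorem coeff_involSer_pow_self (b : A) (m : ℕ) : coeff m (involSer b ^ m) = (-1) ^ m := by
  rw [involSer, neg_mul, neg_pow, mul_pow, ← mul_assoc, mul_comm _ (X ^ m), mul_assoc,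
    coeff_X_pow_mul', if_pos le_rfl]
  simp

theorem coeff_involSer_pow_eq_zero (b : A) {m j : ℕ} (h : j < m) :
    coeff j (involSer b ^ m) = 0 := by
  rw [involSer, neg_mul, neg_pow, mul_pow, ← mul_assoc, mul_comm _ (X ^ m), mul_assoc,
    coeff_X_pow_mul', if_neg h.not_ge]

theorem coeff_subst_involSer (b : A) (f : PowerSeries A) (j : ℕ) :
    coeff j (subst (involSer b) f) =
      ∑ m ∈ Finset.range (j + 1), coeff m f * coeff j (involSer b ^ m) := by
  rw [coeff_subst' (hasSubst_involSer b)]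
  refine finsum_eq_sum_of_support_subset _ fun m hm => ?_
  simp only [Finset.coe_range, Set.mem_Iio]
  by_contra hj
  exact hm (by simp only [coeff_involSer_pow_eq_zero b (show j < m by omega), smul_zero])

/-- The geometric series `1 / (1 - c z)`. -/
def geomSer (c : A) : PowerSeries A := mk fun n => c ^ n

theorem geomSer_mul (c : A) : geomSer c * (1 - C c * X) = 1 := by
  ext n
  rcases n with _ | n
  · simp [geomSer]
  · rw [mul_sub, mul_one, mul_comm (C c), ← mul_assoc, map_sub, coeff_mul_C, coeff_succ_mul_X]
    simp [geomSer, pow_succ, coeff_one]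

theorem invOfUnit_eq_geomSer (c : A) : invOfUnit (1 - C c * X) 1 = geomSer c := by
  have h := geomSer_mul c
  have h' : (1 - C c * X) * invOfUnit (1 - C c * X) 1 = 1 := mul_invOfUnit _ _ (by simp)
  linear_combination geomSer c * h' - invOfUnit (1 - C c * X) 1 * h

theorem derivative_geomSer (c : A) :
    d⁄dX A (geomSer c) = geomSer c * (C c * geomSer c) := by
  have h := geomSer_mul c
  have h1 := congrArg (d⁄dX A) h
  simp only [Derivation.leibniz, map_sub, derivative_X, derivative_C, derivative_one,
    smul_eq_mul] at h1
  linear_combination geomSer c * h1 - d⁄dX A (geomSer c) * h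

/-- The factor of `Q(z)` coming from one variable `x`. -/
def factorSer (b x : A) : PowerSeries A :=
  (1 - C x * involSer b) * invOfUnit (1 - C x * X) 1

/-- Substituting `w` exchanges `1 - x z` and `1 - x w(z)`, since `w` is an involution. -/
theorem factorSer_mul_subst (b x : A) :
    factorSer b x * subst (involSer b) (factorSer b x) = 1 := by
  have hw := hasSubst_involSer b
  have h' : (1 - C x * X) * invOfUnit (1 - C x * X) 1 = 1 := mul_invOfUnit _ _ (by simp)
  have h1 := congrArg (subst (involSer b)) h'
  rw [subst_mul hw, subst_sub hw, subst_mul hw, subst_X hw, subst_one' hw, subst_C_self] at h1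
  rw [factorSer, subst_mul hw, subst_sub hw, subst_mul hw, subst_one' hw, subst_C_self,
    subst_involSer_self]
  linear_combination (1 - C x * involSer b) * subst (involSer b) (invOfUnit (1 - C x * X) 1) * h'
    + h1

theorem factorSer_eq (b x : A) :
    factorSer b x = (1 - C (-(b + x)) * X) * geomSer x * geomSer (-b) := by
  have h := involSer_mul b
  have h1 := geomSer_mul (-b)
  have h2 : involSer b = -X * geomSer (-b) := by
    simp only [map_neg] at h1
    linear_combination geomSer (-b) * h - involSer b * h1
  rw [factorSer, invOfUnit_eq_geomSer, h2]
  simp only [map_neg, map_add] at h1 ⊢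
  linear_combination -geomSer x * h1

/-- The logarithmic derivative of `(1 + (b + x) z) / ((1 + b z) (1 - x z))`. -/
theorem derivative_factorSer (b x : A) :
    d⁄dX A (factorSer b x) = factorSer b x * mk fun n =>
      x ^ (n + 1) - (-(b + x)) ^ (n + 1) + (-b) ^ (n + 1) := by
  have hm : (mk fun n => x ^ (n + 1) - (-(b + x)) ^ (n + 1) + (-b) ^ (n + 1)) =
      C x * geomSer x - C (-(b + x)) * geomSer (-(b + x)) + C (-b) * geomSer (-b) := by
    ext n
    simp only [geomSer, coeff_mk, map_add, map_sub (coeff n), coeff_C_mul, pow_succ']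
  rw [hm, factorSer_eq]
  have h := geomSer_mul (-(b + x))
  simp only [Derivation.leibniz, map_sub, derivative_X, derivative_C, derivative_one,
    smul_eq_mul, derivative_geomSer]
  linear_combination C (-(b + x)) * geomSer x * geomSer (-b) * h

theorem zbar_eq (N : ℕ) : zbar N = involSer (MvPolynomial.C β) := rfl

theorem hasSubst_zbar (N : ℕ) : HasSubst (zbar N) := hasSubst_involSer _

theorem Qser_eq (N : ℕ) :
    Qser N = ∏ i : Fin N, factorSer (MvPolynomial.C β) (MvPolynomial.X i) := rfl

theorem Qser_mul_Qbarser (N : ℕ) : Qser N * Qbarser N = 1 := by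
  rw [Qbarser, Qser_eq, ← coe_substAlgHom (hasSubst_zbar N), map_prod, ← Finset.prod_mul_distrib]
  refine Finset.prod_eq_one fun i _ => ?_
  rw [coe_substAlgHom, zbar_eq, factorSer_mul_subst]

theorem subst_Qbarser (N : ℕ) : subst (zbar N) (Qbarser N) = Qser N := by
  rw [Qbarser, subst_comp_subst_apply (hasSubst_zbar N) (hasSubst_zbar N), zbar_eq,
    subst_involSer_self, X_subst]

theorem qB_zero : qB 0 = 1 := by
  funext N
  simp [qB, Qser, zbar, map_prod]

/-- The relation `A(z) A(z̄) = 1` in each number of variables gives the relation of families. -/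
theorem quadRel_of_mul_subst {a : ℕ → Fam}
    (h : ∀ N, (mk fun n => a n N) * subst (zbar N) (mk fun n => a n N) = 1) : QuadRel K a := by
  refine ⟨fun m j => coeff j (involSer β ^ m), coeff_involSer_pow_self β, fun n hn => ?_⟩
  funext N
  have h1 := congrArg (coeff n) (h N)
  rw [coeff_mul, coeff_one, if_neg hn.ne'] at h1
  rw [Finset.sum_apply, Pi.zero_apply, ← h1]
  refine Finset.sum_congr rfl fun q _ => ?_
  rw [zbar_eq, coeff_subst_involSer, Finset.sum_apply, Finset.mul_sum]
  refine Finset.sum_congr rfl fun m _ => ?_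
  rw [← map_involSer, ← map_pow, coeff_map, coeff_mk, coeff_mk, Pi.smul_apply, Pi.mul_apply,
    MvPolynomial.smul_eq_C_mul]
  ring

theorem quadRel_qB : QuadRel K qB :=
  quadRel_of_mul_subst fun N => by
    have h : (mk fun n => qB n N) = Qser N := by ext1 n; rw [coeff_mk, qB]
    rw [h]
    exact Qser_mul_Qbarser N

theorem quadRel_qbarB : QuadRel K qbarB :=
  quadRel_of_mul_subst fun N => by
    have h : (mk fun n => qbarB n N) = Qbarser N := by ext1 n; rw [coeff_mk, qbarB]
    rw [h, subst_Qbarser, mul_comm, Qser_mul_Qbarser]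

theorem qbarB_zero : qbarB 0 = 1 := by
  funext N
  have h := congrArg (coeff 0) (Qser_mul_Qbarser N)
  have h0 : coeff 0 (Qser N) = 1 := congrFun qB_zero N
  simp only [coeff_zero_eq_constantCoeff, map_mul, map_one] at h h0
  rw [h0, one_mul] at h
  simpa [qbarB] using h

/-- The coefficient of `z^{n-1}` in the logarithmic derivative of `Q^{[β]}(z)`, expressed through
the `p_m^{[β]}`; only the terms with `m = n - j` odd have a nonzero coefficient. -/
def logCoeff (n : ℕ) : Fam :=
  ∑ j ∈ Finset.range n,
    ((n.choose j : K) * (β / 2) ^ j * ((-1) ^ j - (-1) ^ n)) • pB (n - j)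

theorem pB_apply (n N : ℕ) : pB n N =
    ∑ i : Fin N,
      ((MvPolynomial.X i + MvPolynomial.C (β / 2)) ^ n - MvPolynomial.C (β / 2) ^ n) := by
  simp only [pB, p, MvPolynomial.psum, Finset.sum_apply, Pi.smul_apply, Finset.smul_sum]
  rw [Finset.sum_comm]
  refine Finset.sum_congr rfl fun i _ => ?_
  rw [add_comm (MvPolynomial.X i), add_pow, Finset.sum_range_succ]
  simp only [Nat.sub_self, pow_zero, mul_one, Nat.choose_self, Nat.cast_one, add_sub_cancel_right]
  refine Finset.sum_congr rfl fun k _ => ?_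
  rw [MvPolynomial.smul_eq_C_mul, map_mul, map_pow, map_natCast]
  ring

theorem sum_choose_sub {S : Type*} [CommRing S] (y c : S) (n : ℕ) :
    ∑ j ∈ Finset.range n, ((n.choose j : S) * c ^ j * ((-1) ^ j - (-1) ^ n)) * y ^ (n - j) =
      (y - c) ^ n - (-1) ^ n * (y + c) ^ n := by
  have h : ∑ j ∈ Finset.range n,
      ((n.choose j : S) * c ^ j * ((-1) ^ j - (-1) ^ n)) * y ^ (n - j) =
      ∑ j ∈ Finset.range (n + 1),
      ((n.choose j : S) * c ^ j * ((-1) ^ j - (-1) ^ n)) * y ^ (n - j) := by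
    rw [Finset.sum_range_succ]; simp
  rw [h, show y - c = -c + y by ring, add_comm y c, add_pow, add_pow, Finset.mul_sum,
    ← Finset.sum_sub_distrib]
  refine Finset.sum_congr rfl fun j _ => ?_
  rw [neg_pow c]
  ring

theorem logCoeff_apply {n : ℕ} (hn : 0 < n) (N : ℕ) : logCoeff n N =
    ∑ i : Fin N, ((MvPolynomial.X i) ^ n - (-(MvPolynomial.C β + MvPolynomial.X i)) ^ n +
      (-MvPolynomial.C β) ^ n) := by
  have hβ : (MvPolynomial.C β : MvPolynomial (Fin N) K) =
      MvPolynomial.C (β / 2) + MvPolynomial.C (β / 2) := by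
    rw [← map_add, add_halves]
  simp only [logCoeff, Finset.sum_apply, Pi.smul_apply, pB_apply, Finset.smul_sum]
  rw [Finset.sum_comm]
  refine Finset.sum_congr rfl fun i _ => ?_
  have h1 := sum_choose_sub (MvPolynomial.X i + MvPolynomial.C (β / 2))
    (MvPolynomial.C (β / 2) : MvPolynomial (Fin N) K) n
  have h2 := sum_choose_sub (MvPolynomial.C (β / 2))
    (MvPolynomial.C (β / 2) : MvPolynomial (Fin N) K) n
  rw [sub_self, zero_pow hn.ne', ← hβ] at h2
  rw [add_assoc, ← hβ, add_sub_cancel_right] at h1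
  rw [neg_pow (MvPolynomial.C β + MvPolynomial.X i), neg_pow (MvPolynomial.C β),
    add_comm (MvPolynomial.C β)]
  have h3 := congrArg₂ (· - ·) h1 h2
  simp only [← Finset.sum_sub_distrib] at h3
  refine Eq.trans (Finset.sum_congr rfl fun j _ => ?_) (h3.trans (by ring))
  rw [MvPolynomial.smul_eq_C_mul]
  simp only [map_mul, map_pow, map_sub, map_neg, map_one, map_natCast]
  ring

theorem derivative_Qser (N : ℕ) :
    d⁄dX _ (Qser N) = Qser N * mk fun n => logCoeff (n + 1) N := by
  have hm : (mk fun n => logCoeff (n + 1) N) = ∑ i : Fin N, mk fun n =>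
      (MvPolynomial.X i : MvPolynomial (Fin N) K) ^ (n + 1) -
        (-(MvPolynomial.C β + MvPolynomial.X i)) ^ (n + 1) + (-MvPolynomial.C β) ^ (n + 1) := by
    ext1 n
    rw [coeff_mk, logCoeff_apply n.succ_pos, map_sum]
    simp only [coeff_mk]
  rw [hm, Qser_eq]
  induction (Finset.univ : Finset (Fin N)) using Finset.induction_on with
  | empty => simp
  | insert i s hi ih =>
    rw [Finset.prod_insert hi, Finset.sum_insert hi, Derivation.leibniz, ih, smul_eq_mul,
      smul_eq_mul, derivative_factorSer]
    ring

theorem derivative_Qbarser (N : ℕ) :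
    d⁄dX _ (Qbarser N) = -(Qbarser N * mk fun n => logCoeff (n + 1) N) := by
  have h := Qser_mul_Qbarser N
  have h1 := congrArg (d⁄dX _) h
  rw [Derivation.leibniz, smul_eq_mul, smul_eq_mul, derivative_Qser, derivative_one] at h1
  linear_combination Qbarser N * h1 -
    (d⁄dX _ (Qbarser N) + Qbarser N * mk fun n => logCoeff (n + 1) N) * h

theorem logDeriv_qB (n : ℕ) : ((n : K) + 1) • qB (n + 1) =
    (1 : K) • ∑ q ∈ Finset.HasAntidiagonal.antidiagonal n, qB q.1 * logCoeff (q.2 + 1) := by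
  funext N
  have h := congrArg (coeff n) (derivative_Qser N)
  rw [coeff_derivative, coeff_mul] at h
  rw [one_smul, Finset.sum_apply, Pi.smul_apply, MvPolynomial.smul_eq_C_mul, map_add, map_natCast,
    map_one, mul_comm]
  simpa only [coeff_mk, Pi.mul_apply, qB, qbarB] using h

theorem logDeriv_qbarB (n : ℕ) : ((n : K) + 1) • qbarB (n + 1) =
    (-1 : K) • ∑ q ∈ Finset.HasAntidiagonal.antidiagonal n, qbarB q.1 * logCoeff (q.2 + 1) := by
  funext N
  have h := congrArg (coeff n) (derivative_Qbarser N)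
  rw [coeff_derivative, map_neg, coeff_mul] at h
  rw [neg_one_smul, Pi.neg_apply, Finset.sum_apply, Pi.smul_apply, MvPolynomial.smul_eq_C_mul,
    map_add, map_natCast, map_one, mul_comm]
  simpa only [coeff_mk, Pi.mul_apply, qB, qbarB] using h

theorem logCoeff_mem_filt (n : ℕ) : logCoeff n ∈ filt K pB {i | Odd i} n := by
  refine Submodule.sum_mem _ fun j hj => ?_
  rw [Finset.mem_range] at hj
  rcases Nat.even_or_odd (n - j) with he | ho
  · have : (-1 : K) ^ n = (-1) ^ j := by
      conv_lhs => rw [← Nat.sub_add_cancel hj.le, pow_add, he.neg_one_pow, one_mul]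
    rw [this, sub_self, mul_zero, zero_smul]
    exact Submodule.zero_mem _
  · exact Submodule.smul_mem _ _ (self_mem_filt ho (Nat.sub_le n j))

/-- For odd `n` the coefficient of `p_n^{[β]}` in the logarithmic derivative is `2`, so the
relation can be solved for `p_n^{[β]}`. -/
theorem pB_mem_filt_of_logCoeff {a : ℕ → Fam}
    (h : ∀ n, logCoeff (n + 1) ∈ filt K a Set.univ (n + 1)) (n : ℕ) (hn : Odd n) :
    pB n ∈ filt K a Set.univ n := by
  induction n using Nat.strong_induction_on with
  | _ n ih =>
    obtain ⟨k, rfl⟩ := Nat.exists_eq_succ_of_ne_zero hn.pos.ne'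
    have h1 := h k
    rw [logCoeff, Finset.sum_range_succ'] at h1
    have h2 : ∑ j ∈ Finset.range k, (((k + 1).choose (j + 1) : K) * (β / 2) ^ (j + 1) *
        ((-1) ^ (j + 1) - (-1) ^ (k + 1))) • pB (k + 1 - (j + 1)) ∈
        filt K a Set.univ (k + 1) := by
      refine Submodule.sum_mem _ fun j hj => ?_
      rw [Finset.mem_range] at hj
      rcases Nat.even_or_odd (k + 1 - (j + 1)) with he | ho
      · have : (-1 : K) ^ (k + 1) = (-1) ^ (j + 1) := by
          conv_lhs => rw [← Nat.sub_add_cancel (show j + 1 ≤ k + 1 by omega), pow_add,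
            he.neg_one_pow, one_mul]
        rw [this, sub_self, mul_zero, zero_smul]
        exact Submodule.zero_mem _
      · exact Submodule.smul_mem _ _ (filt_mono (by omega) (ih _ (by omega) ho))
    have h3 := (Submodule.add_mem_iff_right _ h2).1 h1
    rw [hn.neg_one_pow] at h3
    norm_num at h3
    exact h3

theorem qB_mem_filt (n : ℕ) : qB n ∈ filt K pB {i | Odd i} n :=
  mem_filt_of_logDeriv qB_zero logDeriv_qB logCoeff_mem_filt n

theorem qbarB_mem_filt (n : ℕ) : qbarB n ∈ filt K pB {i | Odd i} n :=
  mem_filt_of_logDeriv qbarB_zero logDeriv_qbarB logCoeff_mem_filt n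

theorem filt_pB_le_filt_qB (n : ℕ) : filt K pB {i | Odd i} n ≤ filt K qB Set.univ n :=
  filt_le_filt fun i hi => pB_mem_filt_of_logCoeff
    (logDeriv_mem_filt one_ne_zero qB_zero logDeriv_qB) i hi

theorem filt_pB_le_filt_qbarB (n : ℕ) : filt K pB {i | Odd i} n ≤ filt K qbarB Set.univ n :=
  filt_le_filt fun i hi => pB_mem_filt_of_logCoeff
    (logDeriv_mem_filt (neg_ne_zero.2 one_ne_zero) qbarB_zero logDeriv_qbarB) i hi

end Series

/-! ### Generation of symmetric functions by power sums -/

section Generation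

open MvPolynomial

theorem esymm_mem_adjoin_psum (N k : ℕ) (hk : k ≤ N) :
    esymm (Fin N) K k ∈
      Algebra.adjoin K (Set.range fun i : Fin N => psum (Fin N) K ((i : ℕ) + 1)) := by
  induction k using Nat.strong_induction_on with
  | _ k ih =>
    rcases Nat.eq_zero_or_pos k with rfl | hk0
    · rw [esymm_zero]; exact one_mem _
    have h := mul_esymm_eq_sum (Fin N) K k
    have hk' : (k : K) ≠ 0 := by exact_mod_cast hk0.ne'
    have h2 : esymm (Fin N) K k =
        (k : K)⁻¹ • ((k : MvPolynomial (Fin N) K) * esymm (Fin N) K k) := by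
      rw [eq_inv_smul_iff₀ hk', smul_eq_C_mul, map_natCast]
    rw [h2, h]
    refine Subalgebra.smul_mem _ (mul_mem (pow_mem (neg_mem (one_mem _)) _)
      (sum_mem fun a ha => ?_)) _
    rw [Finset.mem_filter, Finset.HasAntidiagonal.mem_antidiagonal] at ha
    refine mul_mem (mul_mem (pow_mem (neg_mem (one_mem _)) _) (ih a.1 ha.2 (by omega)))
      (Algebra.subset_adjoin ⟨⟨a.2 - 1, by omega⟩, ?_⟩)
    simp only
    rw [Nat.sub_add_cancel (by omega)]

theorem IsSymmetric.mem_adjoin_psum {N : ℕ} {f : MvPolynomial (Fin N) K} (hf : f.IsSymmetric) :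
    f ∈ Algebra.adjoin K (Set.range fun i : Fin N => psum (Fin N) K ((i : ℕ) + 1)) := by
  obtain ⟨P, hP⟩ := esymmAlgHom_surjective (σ := Fin N) K (n := N) (by simp) ⟨f, hf⟩
  have h : aeval (fun i : Fin N => esymm (Fin N) K (i + 1)) P = f := by
    rw [← esymmAlgHom_apply, hP]
  rw [← h]
  have h2 : aeval (fun i : Fin N => esymm (Fin N) K (i + 1)) P ∈
      Algebra.adjoin K (Set.range fun i : Fin N => esymm (Fin N) K (i + 1)) := by
    rw [Algebra.adjoin_range_eq_range_aeval]
    exact ⟨P, rfl⟩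
  refine Algebra.adjoin_le ?_ h2
  rintro _ ⟨i, rfl⟩
  exact esymm_mem_adjoin_psum N _ i.2

theorem injective_of_surjective_ringEnd {A : Type*} [CommRing A] [IsNoetherianRing A]
    (f : A →+* A) (hf : Function.Surjective f) : Function.Injective f := by
  have hs : ∀ n : ℕ, Function.Surjective (f^[n]) := fun n => hf.iterate n
  have hcoe : ∀ (n : ℕ) x, (f ^ n) x = f^[n] x := fun n x => by rw [RingHom.coe_pow]
  obtain ⟨n, hn⟩ := monotone_stabilizes_iff_noetherian.2 ‹IsNoetherianRing A›
    ⟨fun n => RingHom.ker (f ^ n), monotone_nat_of_le_succ fun n x hx => by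
      rw [RingHom.mem_ker, hcoe] at hx ⊢
      rw [Function.iterate_succ_apply', hx, map_zero]⟩
  refine (injective_iff_map_eq_zero f).2 fun x hx => ?_
  obtain ⟨y, rfl⟩ := hs n x
  have h1 : y ∈ RingHom.ker (f ^ (n + 1)) := by
    rw [RingHom.mem_ker, hcoe, Function.iterate_succ_apply', hx]
  have h2 : RingHom.ker (f ^ n) = RingHom.ker (f ^ (n + 1)) := hn (n + 1) n.le_succ
  rw [← h2, RingHom.mem_ker, hcoe] at h1
  exact h1

/-- Any `N` generators of the algebra of symmetric polynomials in `N` variables are algebraically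
independent: that algebra is a polynomial ring in `N` variables, and a surjective endomorphism of a
Noetherian ring is injective. -/
theorem algebraicIndependent_of_generate {N : ℕ} {y : Fin N → MvPolynomial (Fin N) K}
    (hy : ∀ i, (y i).IsSymmetric)
    (hgen : ∀ f : MvPolynomial (Fin N) K, f.IsSymmetric → f ∈ Algebra.adjoin K (Set.range y)) :
    AlgebraicIndependent K y := by
  let e := esymmAlgEquiv (Fin N) K (n := N) (by simp)
  let φ : MvPolynomial (Fin N) K →ₐ[K] symmetricSubalgebra (Fin N) K :=
    aeval fun i => ⟨y i, hy i⟩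
  have hφ : ∀ P, (φ P : MvPolynomial (Fin N) K) = aeval y P := fun P =>
    (Subalgebra.mvPolynomial_aeval_coe _ _ _).symm
  have hs : Function.Surjective φ := fun f => by
    have h := hgen f.1 f.2
    rw [Algebra.adjoin_range_eq_range_aeval] at h
    obtain ⟨P, hP⟩ := h
    exact ⟨P, Subtype.ext ((hφ P).trans hP)⟩
  have hi := injective_of_surjective_ringEnd (e.symm.toRingEquiv.toRingHom.comp φ.toRingHom)
    (e.symm.surjective.comp hs)
  rw [algebraicIndependent_iff_injective_aeval]
  intro P Q h
  refine hi ?_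
  have : φ P = φ Q := Subtype.ext (by rw [hφ, hφ, h])
  exact congrArg e.symm this

theorem aeval_fam_apply {σ : Type*} (v : σ → Fam) (P : MvPolynomial σ K) (N : ℕ) :
    (aeval v P) N = aeval (fun i => v i N) P := by
  have h := comp_aeval_apply v (Pi.evalAlgHom K (fun N => MvPolynomial (Fin N) K) N) P
  exact h

theorem p_mem_adjoin_pB (N n : ℕ) (hn : 0 < n) (hN : n ≤ N) :
    p n ∈ Algebra.adjoin K (Set.range fun i : Fin N => pB ((i : ℕ) + 1)) := by
  induction n using Nat.strong_induction_on with
  | _ n ih =>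
    obtain ⟨k, rfl⟩ := Nat.exists_eq_succ_of_ne_zero hn.ne'
    have h : p (k + 1) = pB (k + 1) - ∑ j ∈ Finset.range k,
        (((k + 1).choose (j + 1) : K) * (β / 2) ^ (j + 1)) • p (k + 1 - (j + 1)) := by
      rw [pB, Finset.sum_range_succ']
      simp
    rw [Nat.succ_eq_add_one, h]
    refine sub_mem (Algebra.subset_adjoin ⟨⟨k, hN⟩, rfl⟩) (sum_mem fun j hj => ?_)
    rw [Finset.mem_range] at hj
    exact Subalgebra.smul_mem _ (ih _ (by omega) (by omega) (by omega)) _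

theorem psum_mem_adjoin_pB (N n : ℕ) (hn : 0 < n) (hN : n ≤ N) :
    psum (Fin N) K n ∈ Algebra.adjoin K (Set.range fun i : Fin N => pB ((i : ℕ) + 1) N) := by
  have h := p_mem_adjoin_pB N n hn hN
  rw [Algebra.adjoin_range_eq_range_aeval] at h ⊢
  obtain ⟨P, hP⟩ := h
  refine ⟨P, ?_⟩
  have h2 := aeval_fam_apply (fun i : Fin N => pB ((i : ℕ) + 1)) P N
  exact h2.symm.trans (congrFun hP N)

theorem pB_isSymmetric (n N : ℕ) : (pB n N).IsSymmetric := by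
  rw [pB, Finset.sum_apply]
  exact sum_mem (S := symmetricSubalgebra (Fin N) K) fun k _ =>
    Subalgebra.smul_mem _ (psum_isSymmetric _ _ _) _

theorem algebraicIndependent_pB (N : ℕ) :
    AlgebraicIndependent K fun i : Fin N => pB ((i : ℕ) + 1) N := by
  refine algebraicIndependent_of_generate (fun i => pB_isSymmetric _ _) fun f hf => ?_
  refine Algebra.adjoin_le ?_ (IsSymmetric.mem_adjoin_psum hf)
  rintro _ ⟨i, rfl⟩
  exact psum_mem_adjoin_pB N _ i.1.succ_pos i.2

theorem X_last_dvd_sub_rename (N : ℕ) (h : MvPolynomial (Fin (N + 1)) K) :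
    X (Fin.last N) ∣ h - rename Fin.castSucc (setLastZero N h) := by
  induction h using MvPolynomial.induction_on with
  | C r => simp [setLastZero]
  | add f g hf hg =>
    rw [map_add, map_add, add_sub_add_comm]
    exact dvd_add hf hg
  | mul_X f i hf =>
    rw [map_mul, map_mul]
    have hX : X (Fin.last N) ∣ (X i : MvPolynomial (Fin (N + 1)) K) -
        rename Fin.castSucc (setLastZero N (X i)) := by
      induction i using Fin.lastCases with
      | last => simp [setLastZero]
      | cast i => simp [setLastZero]
    rw [show f * X i - rename Fin.castSucc (setLastZero N f) *
      rename Fin.castSucc (setLastZero N (X i)) =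
      (f - rename Fin.castSucc (setLastZero N f)) * X i + rename Fin.castSucc (setLastZero N f) *
      (X i - rename Fin.castSucc (setLastZero N (X i))) by ring]
    exact dvd_add (dvd_mul_of_dvd_left hf _) (dvd_mul_of_dvd_right hX _)

/-- A symmetric polynomial in `N + 1` variables of degree at most `N` is determined by its
restriction to `N` variables: each of its monomials misses a variable, which symmetry moves to the
last place. -/
theorem eq_zero_of_setLastZero_eq_zero {N : ℕ} {h : MvPolynomial (Fin (N + 1)) K}
    (hs : h.IsSymmetric) (hd : h.totalDegree ≤ N) (h0 : setLastZero N h = 0) : h = 0 := by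
  have hdvd := X_last_dvd_sub_rename N h
  rw [h0, map_zero, sub_zero] at hdvd
  obtain ⟨r, hr⟩ := hdvd
  have hlast : ∀ s : Fin (N + 1) →₀ ℕ, s (Fin.last N) = 0 → coeff s h = 0 := fun s hs => by
    rw [hr, mul_comm, coeff_mul_X', if_neg (by simpa using hs)]
  ext s
  rw [coeff_zero]
  by_contra hne
  have hpos : ∀ i, 1 ≤ s i := fun i => by
    by_contra hi
    refine hne ?_
    rw [← coeff_rename_mapDomain (Equiv.swap i (Fin.last N)) (Equiv.injective _), hs]
    refine hlast _ ?_
    rw [Finsupp.mapDomain_equiv_apply]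
    simp only [Equiv.symm_swap, Equiv.swap_apply_right]
    omega
  have h1 := le_totalDegree (mem_support_iff.2 hne)
  rw [Finsupp.sum_fintype _ _ fun _ => rfl] at h1
  have h2 : N + 1 ≤ ∑ i, s i := by
    simpa using Finset.card_nsmul_le_sum Finset.univ s 1 fun i _ => hpos i
  have h3 : ∑ i, s i ≤ h.totalDegree := h1
  omega

theorem SymFun.eq_zero_of_apply_eq_zero {f : Fam} (hf : f ∈ SymFun) {d : ℕ}
    (hd : ∀ N, (f N).totalDegree ≤ d) (h0 : f d = 0) : f = 0 := by
  funext N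
  rcases le_total d N with h | h
  · induction N, h using Nat.le_induction with
    | base => exact h0
    | succ N hN ih =>
      exact eq_zero_of_setLastZero_eq_zero (hf.1 _) ((hd _).trans hN) ((hf.2.1 N).trans ih)
  · induction h using Nat.decreasingInduction with
    | self => exact h0
    | of_succ N hN ih => rw [← hf.2.1 N, ih]; exact map_zero _

theorem isHomogeneous_psum (N n : ℕ) : (psum (Fin N) K n).IsHomogeneous n :=
  IsHomogeneous.sum _ _ _ fun i _ => isHomogeneous_X_pow i n

theorem p_mem_SymFun {n : ℕ} (hn : 0 < n) : p n ∈ SymFun := by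
  refine ⟨fun N => psum_isSymmetric _ _ _, fun N => ?_, n, fun N =>
    (isHomogeneous_psum N n).totalDegree_le⟩
  simp [p, psum, Fin.sum_univ_castSucc, setLastZero, hn.ne']

theorem IsWeightedHomogeneous.aeval_isHomogeneous {σ : Type*} {N : ℕ} {w : σ → ℕ}
    {P : MvPolynomial σ K} {j : ℕ} (hP : IsWeightedHomogeneous w P j)
    {y : σ → MvPolynomial (Fin N) K} (hy : ∀ i, (y i).IsHomogeneous (w i)) :
    (aeval y P).IsHomogeneous j := by
  rw [aeval_def, eval₂_eq]
  refine IsHomogeneous.sum _ _ _ fun s hs => ?_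
  have h1 := hP (mem_support_iff.1 hs)
  have h2 : (∏ i ∈ s.support, y i ^ s i).IsHomogeneous (∑ i ∈ s.support, w i * s i) :=
    IsHomogeneous.prod _ _ _ fun i _ => (hy i).pow _
  have h3 : ∑ i ∈ s.support, w i * s i = j := by
    rw [← h1, Finsupp.weight_apply, Finsupp.sum]
    exact Finset.sum_congr rfl fun i _ => by rw [smul_eq_mul, mul_comm]
  rw [← h3]
  exact h2.C_mul _

/-- A symmetric function of degree at most `d` agrees in `d` variables with a polynomial `P` in the
power sums; it equals the part of `P` of weight at most `d`, since the difference has degree at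
most `d` and vanishes in `d` variables. -/
theorem SymFun.exists_aeval_p {f : Fam} (hf : f ∈ SymFun) :
    ∃ d, ∃ P : MvPolynomial (Fin d) K, aeval (fun i : Fin d => p ((i : ℕ) + 1)) P = f := by
  obtain ⟨d, hd⟩ := hf.2.2
  have h := IsSymmetric.mem_adjoin_psum (hf.1 d)
  rw [Algebra.adjoin_range_eq_range_aeval] at h
  obtain ⟨P, hP⟩ := h
  let w : Fin d → ℕ := fun i => i + 1
  let P' := ∑ j ∈ Finset.range (d + 1), weightedHomogeneousComponent w j P
  have hhom : ∀ N j, (aeval (fun i : Fin d => psum (Fin N) K ((i : ℕ) + 1))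
      (weightedHomogeneousComponent w j P)).IsHomogeneous j := fun N j =>
    IsWeightedHomogeneous.aeval_isHomogeneous
      (weightedHomogeneousComponent_isWeightedHomogeneous _ _) fun i => isHomogeneous_psum _ _
  have hF : ∀ N, (aeval (fun i : Fin d => p ((i : ℕ) + 1)) P') N =
      ∑ j ∈ Finset.range (d + 1), aeval (fun i : Fin d => psum (Fin N) K ((i : ℕ) + 1))
        (weightedHomogeneousComponent w j P) := fun N => by
    rw [aeval_fam_apply, map_sum]; rfl
  refine ⟨d, P', ?_⟩
  have hmem : aeval (fun i : Fin d => p ((i : ℕ) + 1)) P' ∈ SymFun :=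
    Subalgebra.mvPolynomial_aeval_coe SymFun
      (fun i : Fin d => (⟨p ((i : ℕ) + 1), p_mem_SymFun i.1.succ_pos⟩ : SymFun)) P' ▸
        Subtype.coe_prop _
  refine sub_eq_zero.1 (SymFun.eq_zero_of_apply_eq_zero (sub_mem hmem hf) (d := d) (fun N => ?_) ?_)
  · refine (totalDegree_sub _ _).trans (max_le ?_ (hd N))
    rw [hF]
    refine totalDegree_finsetSum_le fun j hj => (hhom N j).totalDegree_le.trans ?_
    exact Nat.lt_succ_iff.1 (Finset.mem_range.1 hj)
  · rw [Pi.sub_apply, sub_eq_zero, hF]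
    have hcomp : ∀ j, homogeneousComponent j (f d) =
        aeval (fun i : Fin d => psum (Fin d) K ((i : ℕ) + 1))
          (weightedHomogeneousComponent w j P) := fun j => by
      have hfin := weightedHomogeneousComponent_finsupp (w := w) P
      have hP2 : f d = ∑ k ∈ hfin.toFinset ∪ {j},
          aeval (fun i : Fin d => psum (Fin d) K ((i : ℕ) + 1))
            (weightedHomogeneousComponent w k P) := by
        rw [← map_sum, ← hP, ← finsum_eq_sum_of_support_subset, finsum_weightedHomogeneousComponent]
        · rfl
        · exact fun k hk =>
            Finset.mem_coe.2 (Finset.mem_union_left _ ((Set.Finite.mem_toFinset hfin).2 hk))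
      rw [hP2, map_sum, Finset.sum_eq_single j]
      · exact homogeneousComponent_eq_self (hhom d j)
      · intro k _ hk
        rw [homogeneousComponent_of_mem (hhom d k), if_neg hk.symm]
      · intro hj; simp at hj
    have hsum : f d = ∑ j ∈ Finset.range (d + 1), homogeneousComponent j (f d) := by
      conv_lhs => rw [← sum_homogeneousComponent (f d)]
      refine Finset.sum_subset (Finset.range_mono (Nat.succ_le_succ (hd d))) fun j _ hj => ?_
      exact homogeneousComponent_eq_zero _ _ (by rw [Finset.mem_range] at hj; omega)
    rw [hsum]
    exact Finset.sum_congr rfl fun j _ => (hcomp j).symm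

theorem SymFun.exists_aeval_pB {f : Fam} (hf : f ∈ SymFun) :
    ∃ d, ∃ P : MvPolynomial (Fin d) K, aeval (fun i : Fin d => pB ((i : ℕ) + 1)) P = f := by
  obtain ⟨d, P, hP⟩ := SymFun.exists_aeval_p hf
  have h : f ∈ Algebra.adjoin K (Set.range fun i : Fin d => p ((i : ℕ) + 1)) := by
    rw [Algebra.adjoin_range_eq_range_aeval]
    exact ⟨P, hP⟩
  have h2 : f ∈ Algebra.adjoin K (Set.range fun i : Fin d => pB ((i : ℕ) + 1)) := by
    refine Algebra.adjoin_le ?_ h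
    rintro _ ⟨i, rfl⟩
    exact p_mem_adjoin_pB d _ i.1.succ_pos i.2
  rw [Algebra.adjoin_range_eq_range_aeval] at h2
  exact ⟨d, h2⟩

end Generation

/-! ### The cancellation property in terms of the power sums `p_n^{[β]}` -/

section Cancellation

open MvPolynomial

/-- The contribution of the variables `t` and `-t - β` to `p_n^{[β]}`. -/
def pairSum (n : ℕ) : Polynomial K :=
  (Polynomial.X + Polynomial.C (β / 2)) ^ n + (-(Polynomial.X + Polynomial.C (β / 2))) ^ n -
    2 * Polynomial.C (β / 2) ^ n

theorem cancelSubst_pB (n N : ℕ) : cancelSubst N (pB n (N + 2)) =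
    C (pairSum n) +
      mapAlgHom (σ := Fin N) (Polynomial.CAlgHom (R := K) (A := K)) (pB n N) := by
  have hC : ∀ r : K, cancelSubst N (C r) = C (Polynomial.C r) := fun r =>
    (cancelSubst N).commutes r
  have hβ : (Polynomial.C β : Polynomial K) = Polynomial.C (β / 2) + Polynomial.C (β / 2) := by
    rw [← map_add, add_halves]
  rw [pB_apply, pB_apply, Fin.sum_univ_succ, Fin.sum_univ_succ]
  simp only [map_add, map_sum, map_sub, map_pow, hC, mapAlgHom_apply]
  have h0 : cancelSubst N (X 0) = C Polynomial.X := by simp [cancelSubst]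
  have h1 : cancelSubst N (X (Fin.succ 0)) = C (-Polynomial.X - Polynomial.C β) := by
    rw [cancelSubst, aeval_X, Fin.cons_succ, Fin.cons_zero]
  have h2 : ∀ i : Fin N, cancelSubst N (X i.succ.succ) = X i := fun i => by
    rw [cancelSubst, aeval_X, Fin.cons_succ, Fin.cons_succ]
  simp only [h0, h1, h2, hβ, pairSum, map_sub, map_add, map_pow, map_mul, map_neg, map_ofNat,
    map_X, map_C, AlgHom.coe_toRingHom, Polynomial.CAlgHom_apply]
  ring

theorem pB_mem_gGamma {n : ℕ} (hn : Odd n) : pB n ∈ gGamma := by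
  refine ⟨sum_mem fun k hk => Subalgebra.smul_mem _ (p_mem_SymFun ?_) _, fun N => ?_⟩
  · rw [Finset.mem_range] at hk; omega
  · rw [cancelSubst_pB]
    refine add_mem ⟨C (-2 * (β / 2) ^ n), ?_⟩ ⟨pB n N, rfl⟩
    have : pairSum n = Polynomial.C (-2 * (β / 2) ^ n) := by
      rw [pairSum, hn.neg_pow]
      simp only [map_mul, map_neg, map_pow, Polynomial.C_ofNat]
      ring
    rw [this]
    exact map_C _ _

theorem filt_pB_le_gGamma (n : ℕ) :
    filt K pB {i | Odd i} n ≤ Subalgebra.toSubmodule gGamma := by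
  refine Submodule.span_le.2 ?_
  rintro _ ⟨s, hs, -, rfl⟩
  refine gGamma.multiset_prod_mem fun x hx => ?_
  obtain ⟨i, hi, rfl⟩ := Multiset.mem_map.1 hx
  exact pB_mem_gGamma (hs i hi)

/-- The vectors along which a polynomial is translation invariant; in characteristic zero they form
a linear subspace, since a one-variable polynomial that is constant on the integers is constant. -/
def invariantDirections {σ F : Type*} [Field F] [CharZero F] (P : MvPolynomial σ F) :
    Submodule F (σ → F) where
  carrier := {v | ∀ a, eval (a + v) P = eval a P}
  zero_mem' := fun a => by rw [add_zero]
  add_mem' := fun {v w} hv hw a => by rw [← add_assoc, hw, hv]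
  smul_mem' := fun c v hv a => by
    let q : Polynomial F :=
      aeval (fun i => Polynomial.C (a i) + Polynomial.X * Polynomial.C (v i)) P
    have hq : ∀ c, q.eval c = eval (a + c • v) P := fun c => by
      have h := comp_aeval_apply
        (fun i => Polynomial.C (a i) + Polynomial.X * Polynomial.C (v i)) (Polynomial.aeval c) P
      rw [Polynomial.coe_aeval_eq_eval] at h
      refine h.trans ?_
      simp only [Polynomial.eval_C, Polynomial.eval_X, Polynomial.eval_add,
        Polynomial.eval_mul]
      rfl
    have hnat : ∀ n : ℕ, eval (a + (n : F) • v) P = eval a P := fun n => by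
      induction n with
      | zero => simp
      | succ n ih => rw [Nat.cast_succ, add_smul, one_smul, ← add_assoc, hv, ih]
    have h : q = Polynomial.C (eval a P) := by
      refine Polynomial.eq_of_infinite_eval_eq _ _
        ((Set.infinite_range_of_injective (Nat.cast_injective (R := F))).mono ?_)
      rintro _ ⟨n, rfl⟩
      simp only [Set.mem_ofPred_eq, hq, hnat, Polynomial.eval_C]
    rw [← hq, h, Polynomial.eval_C]

/-- The vectors `(u^n + (-u)^n)_n` span the vectors supported on the even positions `n = i + 1`,
by comparing coefficients in a linear relation that holds for all `u`. -/
theorem mem_of_forall_add_neg_pow_mem {F : Type*} [Field F] [CharZero F] {d : ℕ}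
    {H : Submodule F (Fin d → F)}
    (hH : ∀ u : F, (fun i : Fin d => u ^ ((i : ℕ) + 1) + (-u) ^ ((i : ℕ) + 1)) ∈ H)
    {v : Fin d → F} (hv : ∀ i : Fin d, Odd ((i : ℕ) + 1) → v i = 0) : v ∈ H := by
  by_contra hvH
  obtain ⟨f, hfv, hf⟩ := Submodule.exists_le_ker_of_notMem hvH
  refine hfv ?_
  let e : Fin d → F := fun i => f fun j => if i = j then 1 else 0
  have hfe : ∀ w, f w = ∑ i, w i * e i := fun w => LinearMap.pi_apply_eq_sum_univ f w
  let r : Polynomial F := ∑ i : Fin d,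
    Polynomial.C ((1 + (-1) ^ ((i : ℕ) + 1)) * e i) * Polynomial.X ^ ((i : ℕ) + 1)
  have hr : r = 0 := by
    refine Polynomial.funext fun u => ?_
    have h := hf (hH u)
    rw [LinearMap.mem_ker, hfe] at h
    rw [Polynomial.eval_zero, ← h, Polynomial.eval_finsetSum]
    refine Finset.sum_congr rfl fun i _ => ?_
    rw [Polynomial.eval_mul, Polynomial.eval_C, Polynomial.eval_pow, Polynomial.eval_X, neg_pow u]
    ring
  have he : ∀ i : Fin d, Even ((i : ℕ) + 1) → e i = 0 := fun i hi => by
    have h := congrArg (fun q => Polynomial.coeff q ((i : ℕ) + 1)) hr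
    simp only [r, Polynomial.finsetSum_coeff, Polynomial.coeff_C_mul, Polynomial.coeff_X_pow,
      Polynomial.coeff_zero] at h
    rw [Finset.sum_eq_single i (fun j _ hj => by
        rw [if_neg fun h' => hj (Fin.ext (by omega)), mul_zero]) (by simp), if_pos rfl,
      hi.neg_one_pow, mul_one] at h
    exact (mul_eq_zero.1 h).resolve_left (by norm_num)
  rw [hfe]
  refine Finset.sum_eq_zero fun i _ => ?_
  rcases Nat.even_or_odd ((i : ℕ) + 1) with h | h
  · rw [he i h, mul_zero]
  · rw [hv i h, zero_mul]

/-- If `P(p_1^{[β]}, …, p_d^{[β]})` has the cancellation property then `P` is invariant under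
translation by the contributions of the pairs of variables `t, -t - β`. -/
theorem eval_add_neg_pow {d : ℕ} {P : MvPolynomial (Fin d) K}
    (hP : DualKQCancellation (aeval (fun i : Fin d => pB ((i : ℕ) + 1)) P)) (u : K) :
    (fun i : Fin d => u ^ ((i : ℕ) + 1) + (-u) ^ ((i : ℕ) + 1)) ∈ invariantDirections P := by
  obtain ⟨g, hg⟩ := hP d
  rw [aeval_fam_apply, comp_aeval_apply] at hg
  have h1 : ∀ s : K, g = aeval (fun i : Fin d => pB ((i : ℕ) + 1) d)
      (aeval (fun i : Fin d => X i + C ((pairSum ((i : ℕ) + 1)).eval s)) P) := fun s => by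
    let ev := mapAlgHom (σ := Fin d) (Polynomial.aeval (R := K) s)
    have hid : ∀ q : MvPolynomial (Fin d) K,
        ev (mapAlgHom (σ := Fin d) (Polynomial.CAlgHom (R := K) (A := K)) q) = q := fun q => by
      rw [mapAlgHom_apply, mapAlgHom_apply, map_map]
      have : ((Polynomial.aeval (R := K) s : Polynomial K →ₐ[K] K) : Polynomial K →+* K).comp
          ((Polynomial.CAlgHom (R := K) (A := K) : K →ₐ[K] Polynomial K) : K →+* Polynomial K) =
          RingHom.id K := RingHom.ext fun r => Polynomial.aeval_C s r
      rw [this, map_id]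
    have hC : ∀ q : Polynomial K, ev (C q) = C (q.eval s) := fun q => by
      rw [mapAlgHom_apply, map_C]
      rfl
    have h := congrArg ev hg
    rw [comp_aeval_apply] at h
    rw [comp_aeval_apply]
    refine (hid g).symm.trans (h.trans ?_)
    congr 2
    funext i
    rw [cancelSubst_pB, map_add, hC, hid, map_add, aeval_X, add_comm]
    congr 1
    exact (AlgHom.commutes _ _).symm
  -- Compare `t = u - β/2` with `t = -β/2`, where `pairSum` reduces to its constant term.
  have h2 := algebraicIndependent_iff_injective_aeval.1 (algebraicIndependent_pB d)
    ((h1 (u - β / 2)).symm.trans (h1 (-(β / 2))))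
  intro a
  have h3 : ∀ s (b : Fin d → K),
      eval b (aeval (fun i : Fin d => X i + C ((pairSum ((i : ℕ) + 1)).eval s)) P) =
        eval (fun i => b i + (pairSum ((i : ℕ) + 1)).eval s) P := fun s b => by
    have h := comp_aeval_apply (fun i : Fin d => X i + C ((pairSum ((i : ℕ) + 1)).eval s))
      (aeval b : MvPolynomial (Fin d) K →ₐ[K] K) P
    simp only [map_add, aeval_X, aeval_C, Algebra.algebraMap_self, RingHom.id_apply] at h
    exact h
  -- The shift cancels the constant term `-2 (β/2)^n` of `pairSum n`.
  have h4 := congrArg (eval fun i : Fin d => a i + 2 * (β / 2) ^ ((i : ℕ) + 1)) h2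
  rw [h3, h3] at h4
  convert h4 using 3
  · funext i
    simp only [Pi.add_apply, pairSum, Polynomial.eval_sub, Polynomial.eval_add,
      Polynomial.eval_pow, Polynomial.eval_neg, Polynomial.eval_mul, Polynomial.eval_X,
      Polynomial.eval_C, Polynomial.eval_ofNat, sub_add_cancel]
    ring
  · simp [pairSum]

theorem exists_aeval_mem_filt {σ : Type*} {a : ℕ → Fam} {S : Set ℕ} {v : σ → Fam}
    (hv : ∀ i, ∃ n, v i ∈ filt K a S n) (P : MvPolynomial σ K) :
    ∃ n, aeval v P ∈ filt K a S n := by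
  induction P using MvPolynomial.induction_on with
  | C r =>
    refine ⟨0, ?_⟩
    rw [aeval_C, Algebra.algebraMap_eq_smul_one]
    exact Submodule.smul_mem _ _ one_mem_filt
  | add p q hp hq =>
    obtain ⟨m, hm⟩ := hp
    obtain ⟨n, hn⟩ := hq
    rw [map_add]
    exact ⟨max m n, Submodule.add_mem _ (filt_mono (le_max_left _ _) hm)
      (filt_mono (le_max_right _ _) hn)⟩
  | mul_X p i hp =>
    obtain ⟨m, hm⟩ := hp
    obtain ⟨n, hn⟩ := hv i
    rw [map_mul, aeval_X]
    exact ⟨m + n, mul_mem_filt hm hn⟩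

/-- Every element of `gΓ` is a polynomial in the `p_n^{[β]}` with `n` odd: write it as a polynomial
in all the `p_n^{[β]}`; by invariance the even ones may be replaced by zero. -/
theorem exists_mem_filt_of_mem_gGamma {f : Fam} (hf : f ∈ gGamma) :
    ∃ n, f ∈ filt K pB {i | Odd i} n := by
  obtain ⟨d, P, rfl⟩ := SymFun.exists_aeval_pB hf.1
  have hP : P = aeval (fun i : Fin d => if Odd ((i : ℕ) + 1) then X i else 0) P := by
    refine MvPolynomial.funext fun a => ?_
    have h := comp_aeval_apply
      (fun i : Fin d => if Odd ((i : ℕ) + 1) then (X i : MvPolynomial (Fin d) K) else 0)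
      (aeval a : MvPolynomial (Fin d) K →ₐ[K] K) P
    refine Eq.trans ?_ h.symm
    have hv := mem_of_forall_add_neg_pow_mem (eval_add_neg_pow hf.2)
      (v := fun i => if Odd ((i : ℕ) + 1) then 0 else -a i) (fun i hi => if_pos hi) a
    rw [← hv]
    change _ = eval _ P
    congr 2
    funext i
    simp only [Pi.add_apply]
    split_ifs <;> simp
  rw [hP, comp_aeval_apply]
  refine exists_aeval_mem_filt (fun i => ?_) P
  split_ifs with hi
  · exact ⟨_, by rw [aeval_X]; exact self_mem_filt hi le_rfl⟩
  · exact ⟨0, by rw [map_zero]; exact Submodule.zero_mem _⟩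

end Cancellation

/-! ### Bases -/

section Bases

open MvPolynomial

theorem finite_part_le (n : ℕ) : Finite {l : Part // l.1 ≤ n} := by
  refine Finite.of_injective (β := Σ k : Fin (n + 1), Nat.Partition k)
    (fun l => ⟨⟨l.1.1, Nat.lt_succ_of_le l.2⟩, l.1.2⟩) ?_
  rintro ⟨⟨k, p⟩, hk⟩ ⟨⟨m, q⟩, hm⟩ h
  simp only [Sigma.mk.injEq, Fin.mk.injEq] at h
  obtain ⟨rfl, h⟩ := h
  obtain rfl := eq_of_heq h
  rfl

theorem finite_subtype_part_le (Q : Part → Prop) (n : ℕ) :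
    Finite {l : {l : Part // Q l} // l.1.1 ≤ n} :=
  have := finite_part_le n
  Finite.of_injective (β := {l : Part // l.1 ≤ n}) (fun l => ⟨l.1.1, l.2⟩) fun l m h => by
    have h' : l.1.1 = m.1.1 := Subtype.mk.inj h
    exact Subtype.ext (Subtype.ext h')

/-- A size-preserving bijection between odd and strict partitions, from Euler's theorem. -/
theorem exists_equiv_oddPart_strictPart : ∃ e : OddPart ≃ StrictPart, ∀ l, (e l).1.1 = l.1.1 := by
  classical
  have h : ∀ n : ℕ, Nonempty ({q : Nat.Partition n // ∀ i ∈ q.parts, Odd i} ≃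
      {q : Nat.Partition n // q.parts.Nodup}) := fun n => by
    refine ⟨Fintype.equivOfCardEq ?_⟩
    rw [Fintype.card_subtype, Fintype.card_subtype]
    have := Nat.Partition.card_odds_eq_card_distincts n
    simpa only [Nat.Partition.odds, Nat.Partition.restricted, Nat.Partition.distincts,
      Nat.not_even_iff_odd] using this
  obtain ⟨e⟩ := Classical.nonempty_pi.2 h
  exact ⟨⟨fun l => ⟨⟨l.1.1, (e _ ⟨l.1.2, l.2⟩).1⟩, (e _ ⟨l.1.2, l.2⟩).2⟩,
    fun l => ⟨⟨l.1.1, ((e _).symm ⟨l.1.2, l.2⟩).1⟩, ((e _).symm ⟨l.1.2, l.2⟩).2⟩,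
    fun ⟨⟨n, q⟩, hq⟩ => by simp, fun ⟨⟨n, q⟩, hq⟩ => by simp⟩, fun l => rfl⟩

theorem card_oddPart_le_eq (n : ℕ) :
    Nat.card {l : OddPart // l.1.1 ≤ n} = Nat.card {l : StrictPart // l.1.1 ≤ n} := by
  obtain ⟨e, he⟩ := exists_equiv_oddPart_strictPart
  exact Nat.card_congr (e.subtypeEquiv fun l => by rw [he])

theorem partProd_pB_eq_aeval {n : ℕ} (l : Part) (hl : l.1 ≤ n) :
    partProd pB l = aeval (fun i : Fin n => pB ((i : ℕ) + 1))
      (monomial (Finsupp.equivFunOnFinite.symm fun i : Fin n => l.2.parts.count ((i : ℕ) + 1))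
        (1 : K)) := by
  rw [aeval_monomial, map_one, one_mul, Finsupp.prod_fintype _ _ fun i => pow_zero _, partProd,
    Finset.prod_multiset_map_count]
  simp only [Finsupp.equivFunOnFinite_symm_apply_apply]
  rw [Fin.prod_univ_eq_prod_range (fun i => pB (i + 1) ^ l.2.parts.count (i + 1)) n,
    Finset.range_eq_Ico, Finset.prod_Ico_add' (fun i => pB i ^ l.2.parts.count i) 0 n 1]
  refine Finset.prod_subset (fun i hi => ?_) fun i _ hi => ?_
  · have hi' := Multiset.mem_toFinset.1 hi
    have h1 := l.2.parts_pos hi'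
    have h2 := l.2.le_of_mem_parts hi'
    rw [Finset.mem_Ico]
    omega
  · rw [Multiset.mem_toFinset] at hi
    rw [Multiset.count_eq_zero_of_notMem hi, pow_zero]

/-- The products `p_λ^{[β]}` over all partitions of size at most `n` are distinct monomials in the
algebraically independent `p_1^{[β]}, …, p_n^{[β]}`. -/
theorem linearIndependent_partProd_pB (n : ℕ) :
    LinearIndependent K fun l : {l : Part // l.1 ≤ n} => partProd pB l.1 := by
  have hinj : Function.Injective
      (aeval (fun i : Fin n => pB ((i : ℕ) + 1)) : MvPolynomial (Fin n) K →ₐ[K] Fam) := by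
    intro P Q h
    refine algebraicIndependent_iff_injective_aeval.1 (algebraicIndependent_pB n) ?_
    have := congrFun h n
    rwa [aeval_fam_apply, aeval_fam_apply] at this
  have h1 := (basisMonomials (Fin n) K).linearIndependent.comp
    (fun l : {l : Part // l.1 ≤ n} =>
      Finsupp.equivFunOnFinite.symm fun i : Fin n => l.1.2.parts.count ((i : ℕ) + 1)) (by
    rintro ⟨⟨k, q⟩, hk⟩ ⟨⟨m, r⟩, hm⟩ h
    have h := Finsupp.equivFunOnFinite.symm.injective h
    have hparts : q.parts = r.parts := by
      ext i
      rcases Nat.eq_zero_or_pos i with rfl | hi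
      · rw [Multiset.count_eq_zero_of_notMem fun h => (q.parts_pos h).ne rfl,
          Multiset.count_eq_zero_of_notMem fun h => (r.parts_pos h).ne rfl]
      · rcases le_or_gt i n with hin | hin
        · have := congrFun h ⟨i - 1, by omega⟩
          simpa only [Nat.sub_add_cancel hi] using this
        · rw [Multiset.count_eq_zero_of_notMem fun h => ?_,
            Multiset.count_eq_zero_of_notMem fun h => ?_]
          · have := r.le_of_mem_parts h; simp only at hm; omega
          · have := q.le_of_mem_parts h; simp only at hk; omega
    obtain rfl : k = m := by rw [← q.parts_sum, ← r.parts_sum, hparts]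
    obtain rfl := Nat.Partition.ext hparts
    rfl)
  have h2 := h1.map' (aeval (fun i : Fin n => pB ((i : ℕ) + 1)) :
    MvPolynomial (Fin n) K →ₐ[K] Fam).toLinearMap (LinearMap.ker_eq_bot.2 hinj)
  rw [coe_basisMonomials] at h2
  rw [show (fun l : {l : Part // l.1 ≤ n} => partProd pB l.1) = _ from
    funext fun l => partProd_pB_eq_aeval l.1 l.2]
  exact h2

theorem linearIndependent_oddPart_pB (n : ℕ) :
    LinearIndependent K fun l : {l : OddPart // l.1.1 ≤ n} => partProd pB l.1.1 :=
  (linearIndependent_partProd_pB n).comp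
    (fun l : {l : OddPart // l.1.1 ≤ n} => ⟨l.1.1, l.2⟩) fun l m h => by
      have h' : l.1.1 = m.1.1 := Subtype.mk.inj h
      exact Subtype.ext (Subtype.ext h')

theorem linearIndependent_of_forall_le {ι M : Type*} [AddCommGroup M] [Module K M] {v : ι → M}
    (wt : ι → ℕ) (h : ∀ n, LinearIndependent K fun i : {i // wt i ≤ n} => v i) :
    LinearIndependent K v := by
  rw [linearIndependent_iff']
  intro s g hg i hi
  have hle : ∀ j ∈ s, wt j ≤ s.sup wt := fun j hj => Finset.le_sup hj
  have h1 := (h (s.sup wt)).comp (fun j : s => ⟨j.1, hle j.1 j.2⟩) fun j k hjk =>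
    Subtype.ext (congrArg (fun x => x.1) hjk)
  rw [Fintype.linearIndependent_iff] at h1
  exact h1 (fun j => g j) (by rw [← hg, ← Finset.sum_coe_sort s]; rfl) ⟨i, hi⟩

theorem partProd_mem_filt (a : ℕ → Fam) {S : Set ℕ} (l : Part) (hl : ∀ i ∈ l.2.parts, i ∈ S) :
    partProd a l ∈ filt K a S l.1 :=
  prod_mem_filt hl l.2.parts_sum.le

theorem filt_odd_le_span (a : ℕ → Fam) (n : ℕ) : filt K a {i | Odd i} n ≤
    Submodule.span K (Set.range fun l : {l : OddPart // l.1.1 ≤ n} => partProd a l.1.1) := by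
  refine Submodule.span_mono ?_
  rintro _ ⟨s, hs, hn, rfl⟩
  exact ⟨⟨⟨⟨s.sum, s, fun hi => (hs _ hi).pos, rfl⟩, hs⟩, hn⟩, rfl⟩

theorem strictFilt_le_span (a : ℕ → Fam) (n : ℕ) : strictFilt K a n ≤
    Submodule.span K (Set.range fun l : {l : StrictPart // l.1.1 ≤ n} => partProd a l.1.1) := by
  refine Submodule.span_mono ?_
  rintro _ ⟨s, hs, h0, hn, rfl⟩
  exact ⟨⟨⟨⟨s.sum, s, fun {i} hi => Nat.pos_of_ne_zero fun h => h0 (h ▸ hi), rfl⟩, hs⟩, hn⟩, rfl⟩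

/-- Elements of `gΓ` indexed by as many labels of each bounded weight as there are odd partitions,
whose spans contain the products of the `p_n^{[β]}`, form a basis: within each weight bound the
dimension of the span is at least the number of vectors, so they are linearly independent. -/
theorem isBasisOfGGamma_of_span {Q : Part → Prop} {v : {l : Part // Q l} → Fam}
    (hmem : ∀ l, v l ∈ gGamma)
    (hcard : ∀ n, Nat.card {l : {l : Part // Q l} // l.1.1 ≤ n} =
      Nat.card {l : OddPart // l.1.1 ≤ n})
    (hspan : ∀ n, filt K pB {i | Odd i} n ≤
      Submodule.span K (Set.range fun l : {l : {l : Part // Q l} // l.1.1 ≤ n} => v l.1)) :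
    IsBasisOfGGamma v := by
  have hLI : LinearIndependent K v := by
    refine linearIndependent_of_forall_le (fun l => l.1.1) fun n => ?_
    have := finite_subtype_part_le Q n
    have := finite_subtype_part_le (fun l => ∀ i ∈ l.2.parts, Odd i) n
    have := Fintype.ofFinite {l : {l : Part // Q l} // l.1.1 ≤ n}
    have := Fintype.ofFinite {l : OddPart // l.1.1 ≤ n}
    rw [linearIndependent_iff_card_le_finrank_span, ← Nat.card_eq_fintype_card, hcard,
      Nat.card_eq_fintype_card, ← finrank_span_eq_card (linearIndependent_oddPart_pB n)]
    have : Module.Finite K (Submodule.span K (Set.range fun l : {l : {l : Part // Q l} //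
      l.1.1 ≤ n} => v l.1)) := Module.Finite.span_of_finite K (Set.finite_range _)
    refine Submodule.finrank_mono (le_trans (Submodule.span_le.2 ?_) (hspan n))
    rintro _ ⟨l, rfl⟩
    exact filt_mono l.2 (partProd_mem_filt pB l.1.1 l.1.2)
  let w : {l : Part // Q l} → gGamma := fun l => ⟨v l, hmem l⟩
  have hw : LinearIndependent K w :=
    LinearIndependent.of_comp (Subalgebra.toSubmodule gGamma).subtype hLI
  refine ⟨Module.Basis.mk hw ?_, fun l => by rw [Module.Basis.mk_apply]⟩
  rintro ⟨f, hf⟩ -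
  obtain ⟨n, hn⟩ := exists_mem_filt_of_mem_gGamma hf
  have h1 : f ∈ Submodule.span K (Set.range v) :=
    Submodule.span_mono (by rintro _ ⟨l, rfl⟩; exact ⟨l.1, rfl⟩) (hspan n hn)
  have h2 : Submodule.span K (Set.range v) =
      (Submodule.span K (Set.range w)).map (Subalgebra.toSubmodule gGamma).subtype := by
    rw [Submodule.map_span, ← Set.range_comp]
    rfl
  rw [h2] at h1
  obtain ⟨x, hx, hxf⟩ := h1
  have : x = ⟨f, hf⟩ := Subtype.ext hxf
  exact this ▸ hx

theorem partProd_mem_gGamma {a : ℕ → Fam} (ha : ∀ n, a n ∈ filt K pB {i | Odd i} n) (l : Part) :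
    partProd a l ∈ gGamma :=
  filt_pB_le_gGamma l.1 (filt_le_filt (T := Set.univ) (fun i _ => ha i)
    (partProd_mem_filt a l fun _ _ => Set.mem_univ _))

theorem isBasisOfGGamma_pB : IsBasisOfGGamma fun l : OddPart => partProd pB l.1 :=
  isBasisOfGGamma_of_span
    (fun l => filt_pB_le_gGamma l.1.1 (partProd_mem_filt pB l.1 l.2)) (fun _ => rfl)
    (filt_odd_le_span pB)

theorem isBasisOfGGamma_oddPart {a : ℕ → Fam} (h : QuadRel K a) (h0 : a 0 = 1)
    (ha : ∀ n, a n ∈ filt K pB {i | Odd i} n)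
    (hp : ∀ n, filt K pB {i | Odd i} n ≤ filt K a Set.univ n) :
    IsBasisOfGGamma fun l : OddPart => partProd a l.1 :=
  isBasisOfGGamma_of_span (fun l => partProd_mem_gGamma ha l.1) (fun _ => rfl) fun n =>
    ((hp n).trans (h.filt_univ_le_odd h0 n)).trans (filt_odd_le_span a n)

theorem isBasisOfGGamma_strictPart {a : ℕ → Fam} (h : QuadRel K a) (h0 : a 0 = 1)
    (ha : ∀ n, a n ∈ filt K pB {i | Odd i} n)
    (hp : ∀ n, filt K pB {i | Odd i} n ≤ filt K a Set.univ n) :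
    IsBasisOfGGamma fun l : StrictPart => partProd a l.1 :=
  isBasisOfGGamma_of_span (fun l => partProd_mem_gGamma ha l.1)
    (fun n => (card_oddPart_le_eq n).symm) fun n =>
    ((hp n).trans (h.filt_univ_le_strictFilt h0 n)).trans (strictFilt_le_span a n)

end Bases

end

end DualKQ

theorem mainTheorem4 :
    DualKQ.IsBasisOfGGamma (fun l : DualKQ.OddPart => DualKQ.partProd DualKQ.pB l.1) ∧
    DualKQ.IsBasisOfGGamma (fun l : DualKQ.OddPart => DualKQ.partProd DualKQ.qB l.1) ∧
    DualKQ.IsBasisOfGGamma (fun l : DualKQ.OddPart => DualKQ.partProd DualKQ.qbarB l.1) ∧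
    DualKQ.IsBasisOfGGamma (fun l : DualKQ.StrictPart => DualKQ.partProd DualKQ.qB l.1) ∧
    DualKQ.IsBasisOfGGamma (fun l : DualKQ.StrictPart => DualKQ.partProd DualKQ.qbarB l.1) := by
  open DualKQ in
  exact ⟨isBasisOfGGamma_pB,
    isBasisOfGGamma_oddPart quadRel_qB qB_zero qB_mem_filt filt_pB_le_filt_qB,
    isBasisOfGGamma_oddPart quadRel_qbarB qbarB_zero qbarB_mem_filt filt_pB_le_filt_qbarB,
    isBasisOfGGamma_strictPart quadRel_qB qB_zero qB_mem_filt filt_pB_le_filt_qB,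
    isBasisOfGGamma_strictPart quadRel_qbarB qbarB_zero qbarB_mem_filt filt_pB_le_filt_qbarB⟩
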